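/- Let $K$ be a field and let $E=(E^0,E^1,r,s)$ be an arbitrary directed graph (any sets of vertices and edges; loops, multiple edges, sinks and infinite emitters are allowed). The Leavitt path algebra $L_K(E)$ is the associative, not necessarily unital, $K$-algebra generated by $\{v\mid v\in E^0\}\cup\{e,e^*\mid e\in E^1\}$ subject to the relations: the $v\in E^0$ are pairwise orthogonal idempotents; $s(e)e=er(e)=e$ and $r(e)e^*=e^*s(e)=e^*$ for all $e\in E^1$; $e^*f=\delta_{e,f}\,r(e)$ for all $e,f\in E^1$; and $v=\sum_{e\in s^{-1}(v)}ee^*$ for every vertex $v$ with $s^{-1}(v)$ finite and nonempty. For a path $p=e_1\cdots e_n$ with $r(e_i)=s(e_{i+1})$ put $l(p)=n$ and $p^*=e_n^*\cdots e_1^*$; vertices are the paths of length $0$, with $v^*=v$. The algebra $L_K(E)$ is $\mathbb{Z}$-graded, with $L_K(E)_n$ the $K$-span of all $pq^*$, where $p,q$ are paths with $l(p)-l(q)=n$. Rings are associative and not necessarily unital, and ring homomorphisms are not assumed to be $K$-linear or unital. (1) (Graded Uniqueness) If $A=\bigoplus_{n\in\mathbb{Z}}A_n$ is a $\mathbb{Z}$-graded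 ring and $\pi:L_K(E)\to A$ is a ring homomorphism with $\pi(L_K(E)_n)\subseteq A_n$ for all $n\in\mathbb{Z}$ and $\pi(v)\neq 0$ for every $v\in E^0$, then $\pi$ is injective. (2) (Cuntz--Krieger Uniqueness) Suppose that $E$ satisfies Condition (L): for every cycle $e_1\cdots e_n$ (that is, $n\ge 1$, $r(e_i)=s(e_{i+1})$ for $1\le i<n$, $r(e_n)=s(e_1)$, and $s(e_i)\neq s(e_j)$ for $i\ne j$) there are an index $i$ and an edge $e\neq e_i$ with $s(e)=s(e_i)$. If $A$ is any ring and $\pi:L_K(E)\to A$ is a ring homomorphism with $\pi(v)\neq 0$ for every $v\in E^0$, then $\pi$ is injective. -/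

import Mathlib

/-! A directed graph `E` is a quiver on its type of vertices `V`: multiple edges and loops are
allowed and there is no finiteness or countability assumption. The set of edges is
`Quiver.Total V`; the source of `e` is `e.left` and its range is `e.right`. A path from `a` to `b`
is a `Quiver.Path a b`; the paths of length zero are the vertices. -/

namespace DirectedGraph

universe v u

variable {V : Type u} [Quiver.{v} V]

/-- The list of edges `e₁, …, eₙ` of a path `e₁ ⋯ eₙ`. -/
def edges {a : V} : ∀ {b : V}, Quiver.Path a b → List (Quiver.Total V)
  | _, .nil => []
  | _, .cons p e => edges p ++ [⟨_, _, e⟩]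

/-- A closed path `e₁ ⋯ eₙ`, `n ≥ 1`, is a cycle if `s(eᵢ) ≠ s(eⱼ)` for all `i ≠ j`. -/
def IsCycle {a : V} (p : Quiver.Path a a) : Prop :=
  0 < p.length ∧ (edges p).Pairwise fun e f => e.left ≠ f.left

/-- An edge `e` is an exit for the path `e₁ ⋯ eₙ` if `s(e) = s(eᵢ)` and `e ≠ eᵢ` for some `i`. -/
def IsExit {a b : V} (e : Quiver.Total V) (p : Quiver.Path a b) : Prop :=
  ∃ f ∈ edges p, e.left = f.left ∧ e ≠ f

variable (V) in
/-- Condition (L): every cycle has an exit. -/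
def ConditionL : Prop :=
  ∀ (a : V) (p : Quiver.Path a a), IsCycle p → ∃ e, IsExit e p

/-- The set `s⁻¹(w)` of edges emitted by the vertex `w`. -/
def emitted (w : V) : Set (Quiver.Total V) := {e | e.left = w}

end DirectedGraph

namespace LeavittPath

universe k v u

open DirectedGraph

variable (K : Type k) [Field K] (V : Type u) [Quiver.{v} V]

/-- The generators: vertices, real edges and ghost edges. -/
inductive Generator : Type (max u v)
  | vertex (w : V)
  | edge (e : Quiver.Total V)
  | ghost (e : Quiver.Total V)

/-- The free associative (not necessarily unital) `K`-algebra on the generators, with basis the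
nonempty words in them. -/
abbrev FreeAlg := MonoidAlgebra K (FreeSemigroup (Generator V))

variable {V}

/-- A generator as an element of the free algebra. -/
noncomputable def FreeAlg.gen (x : Generator V) : FreeAlg K V :=
  MonoidAlgebra.single (FreeSemigroup.of x) 1

/-- The vertex `w` in the free algebra. -/
noncomputable abbrev FreeAlg.vert (w : V) : FreeAlg K V := FreeAlg.gen K (.vertex w)
/-- The real edge `e` in the free algebra. -/
noncomputable abbrev FreeAlg.edge (e : Quiver.Total V) : FreeAlg K V := FreeAlg.gen K (.edge e)
/-- The ghost edge `e*` in the free algebra. -/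
noncomputable abbrev FreeAlg.ghost (e : Quiver.Total V) : FreeAlg K V := FreeAlg.gen K (.ghost e)

open FreeAlg

/-- The defining relations of the Leavitt path algebra. -/
inductive Rel : FreeAlg K V → FreeAlg K V → Prop
  | vertex_idem (w : V) : Rel (vert K w * vert K w) (vert K w)
  | vertex_orth (w w' : V) (h : w ≠ w') : Rel (vert K w * vert K w') 0
  | source_edge (e : Quiver.Total V) : Rel (vert K e.left * edge K e) (edge K e)
  | edge_range (e : Quiver.Total V) : Rel (edge K e * vert K e.right) (edge K e)
  | range_ghost (e : Quiver.Total V) : Rel (vert K e.right * ghost K e) (ghost K e)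
  | ghost_source (e : Quiver.Total V) : Rel (ghost K e * vert K e.left) (ghost K e)
  | ghost_edge_self (e : Quiver.Total V) : Rel (ghost K e * edge K e) (vert K e.right)
  | ghost_edge_ne (e f : Quiver.Total V) (h : e ≠ f) : Rel (ghost K e * edge K f) 0
  | regular (w : V) (hfin : (emitted w).Finite) (hne : (emitted w).Nonempty) :
      Rel (vert K w) (∑ e ∈ hfin.toFinset, edge K e * ghost K e)

variable (V)

/-- The congruence modulo the two-sided algebra ideal generated by the relations. -/
noncomputable def con : RingCon (FreeAlg K V) :=
  ringConGen fun x y => ∃ (c : K) (a b : FreeAlg K V), Rel K a b ∧ x = c • a ∧ y = c • b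

variable {V} in
theorem con_smul (c : K) {x y : FreeAlg K V} (h : con K V x y) : con K V (c • x) (c • y) := by
  change RingConGen.Rel _ x y at h
  change RingConGen.Rel _ (c • x) (c • y)
  induction h with
  | of x y h =>
    obtain ⟨d, a, b, hab, rfl, rfl⟩ := h
    exact .of _ _ ⟨c * d, a, b, hab, smul_smul .., smul_smul ..⟩
  | refl x => exact .refl _
  | symm _ ih => exact .symm ih
  | trans _ _ ih₁ ih₂ => exact .trans ih₁ ih₂
  | add _ _ ih₁ ih₂ => rw [smul_add, smul_add]; exact .add ih₁ ih₂
  | mul _ h₂ ih₁ _ => rw [← smul_mul_assoc, ← smul_mul_assoc]; exact .mul ih₁ h₂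

end LeavittPath

open LeavittPath in
/-- The Leavitt path algebra `L_K(E)`: the associative, not necessarily unital `K`-algebra
presented by the generators and relations above. -/
def LeavittPathAlgebra (K : Type*) [Field K] (V : Type*) [Quiver V] : Type _ :=
  (con K V).Quotient

namespace LeavittPathAlgebra

universe k v u

open LeavittPath DirectedGraph

variable (K : Type k) [Field K] (V : Type u) [Quiver.{v} V]

noncomputable instance : NonUnitalRing (LeavittPathAlgebra K V) :=
  inferInstanceAs (NonUnitalRing (con K V).Quotient)

/-- The quotient map from the free algebra. -/
noncomputable def mk (x : FreeAlg K V) : LeavittPathAlgebra K V := (x : (con K V).Quotient)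

theorem mk_surjective : Function.Surjective (mk K V) := Quotient.mk''_surjective

noncomputable instance : SMul K (LeavittPathAlgebra K V) where
  smul c := Quotient.map' (c • ·) fun _ _ h => con_smul K c h

noncomputable instance : Module K (LeavittPathAlgebra K V) :=
  Function.Surjective.module K
    ({ toFun := mk K V, map_zero' := rfl, map_add' := fun _ _ => rfl } :
      FreeAlg K V →+ LeavittPathAlgebra K V)
    (mk_surjective K V) fun _ _ => rfl

instance : IsScalarTower K (LeavittPathAlgebra K V) (LeavittPathAlgebra K V) where
  smul_assoc c x y := by
    obtain ⟨x, rfl⟩ := mk_surjective K V x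
    obtain ⟨y, rfl⟩ := mk_surjective K V y
    exact congrArg (mk K V) (smul_mul_assoc c x y)

instance : SMulCommClass K (LeavittPathAlgebra K V) (LeavittPathAlgebra K V) where
  smul_comm c x y := by
    obtain ⟨x, rfl⟩ := mk_surjective K V x
    obtain ⟨y, rfl⟩ := mk_surjective K V y
    exact congrArg (mk K V) (mul_smul_comm c x y).symm

variable {V}

/-- The vertex `w` as an element of `L_K(E)`. -/
noncomputable def vertex (w : V) : LeavittPathAlgebra K V := mk K V (FreeAlg.vert K w)

/-- The edge `e` as an element of `L_K(E)`. -/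
noncomputable def edge (e : Quiver.Total V) : LeavittPathAlgebra K V := mk K V (FreeAlg.edge K e)

/-- The ghost edge `e*` as an element of `L_K(E)`. -/
noncomputable def ghost (e : Quiver.Total V) : LeavittPathAlgebra K V :=
  mk K V (FreeAlg.ghost K e)

/-- The path `p = e₁ ⋯ eₙ` as an element of `L_K(E)`. -/
noncomputable def path {a : V} : ∀ {b : V}, Quiver.Path a b → LeavittPathAlgebra K V
  | _, .nil => vertex K a
  | _, .cons p e => path p * edge K ⟨_, _, e⟩

/-- The element `p* = eₙ* ⋯ e₁*` of `L_K(E)`. -/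
noncomputable def pathStar {a : V} : ∀ {b : V}, Quiver.Path a b → LeavittPathAlgebra K V
  | _, .nil => vertex K a
  | _, .cons p e => ghost K ⟨_, _, e⟩ * pathStar p

variable (V)

/-- The homogeneous component `L_K(E)_n`: the `K`-span of all elements `p q*`, where `p` and `q`
are paths with `l(p) - l(q) = n`. -/
noncomputable def component (n : ℤ) : Submodule K (LeavittPathAlgebra K V) :=
  Submodule.span K {x | ∃ (a b c d : V) (p : Quiver.Path a b) (q : Quiver.Path c d),
    (p.length : ℤ) - (q.length : ℤ) = n ∧ x = path K p * pathStar K q}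

end LeavittPathAlgebra

/-! Both theorems reduce to one statement: if combinations of paths ending at a common vertex are
never killed by `π` unless all coefficients vanish (`IndepPaths`), then `π` is injective on each
piece `filtrationUnion`. The parameter `t` treats the two cases together: `t = 1` keeps the grading,
`t = 0` puts everything in degree 0.

The reduction (`IndepPaths.eq_zero_of_mem_filtration`) is an induction on the ghost length `d`.
Since e*f = δ r(e), right multiplication by an edge lowers `d`, so an element x of the kernel
satisfies xe = 0 for every edge e. It remains to see that xw = 0 for every vertex w. At a regular
vertex this is w = ∑ ee*. At a sink or an infinite emitter the ghost-free part of xw vanishes by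
independence, and then so do the other terms.

For independence, multiplying on the left by p₀*, with p₀ of minimal length, leaves a nonzero
multiple of a vertex plus nontrivial closed paths. In the graded case all lengths agree and no
closed path survives. Under Condition (L) an exit provides a path p with p*cp = 0, so the closed
paths c are conjugated away one at a time. -/

namespace DirectedGraph

universe v u

variable {V : Type u} [Quiver.{v} V]

/-! ### Closed paths and exits in the graph. -/

theorem edges_comp {a b c : V} (p : Quiver.Path a b) (q : Quiver.Path b c) :
    edges (p.comp q) = edges p ++ edges q := by
  induction q with
  | nil => simp [edges]
  | cons q e ih => simp [edges, ih]

theorem exists_eq_comp_of_mem_edges {a b : V} (p : Quiver.Path a b) {e : Quiver.Total V}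
    (he : e ∈ edges p) :
    ∃ (q : Quiver.Path a e.left) (r : Quiver.Path e.right b), p = (q.cons e.hom).comp r := by
  induction p with
  | nil => simp [edges] at he
  | cons p f ih =>
    rw [edges, List.mem_append, List.mem_singleton] at he
    rcases he with he | rfl
    · obtain ⟨q, r, rfl⟩ := ih he
      exact ⟨q, r.cons f, rfl⟩
    · exact ⟨p, .nil, rfl⟩

/-- Either the edges of a path have distinct sources, or a nontrivial closed path can be split off
strictly before the end. -/
theorem pairwise_or_exists_closed_subpath {a b : V} (p : Quiver.Path a b) :
    ((edges p).Pairwise fun e f => e.left ≠ f.left) ∨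
      ∃ (x : V) (q : Quiver.Path a x) (c : Quiver.Path x x) (r : Quiver.Path x b),
        0 < c.length ∧ 0 < r.length ∧ p = (q.comp c).comp r := by
  induction p with
  | nil => exact .inl List.Pairwise.nil
  | cons p e ih =>
    rename_i x y
    rcases ih with h | ⟨x, q, c, r, hc, hr, rfl⟩
    · by_cases hx : ∃ f ∈ edges p, f.left = x
      · obtain ⟨f, hf, rfl⟩ := hx
        obtain ⟨q, r, rfl⟩ := exists_eq_comp_of_mem_edges p hf
        -- The source of the last edge `e` already occurs as the source of `f`, so the stretch from
        -- `f` up to `e` is closed; `e` itself is left over.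
        refine .inr ⟨f.left, q, f.hom.toPath.comp r, e.toPath, ?_, ?_, ?_⟩
        · simp [Quiver.Path.length_comp, Quiver.Hom.toPath]
        · simp [Quiver.Hom.toPath]
        · simp only [Quiver.Hom.toPath, Quiver.Path.comp_cons, Quiver.Path.comp_nil,
            ← Quiver.Path.comp_assoc]
      · push Not at hx
        refine .inl (List.pairwise_append.2 ⟨h, List.pairwise_singleton _ _, ?_⟩)
        intro f hf g hg
        rw [List.mem_singleton] at hg
        subst hg
        exact hx f hf
    · exact .inr ⟨x, q, c, r.cons e, hc, Nat.succ_pos _, rfl⟩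

/-- Under Condition (L) every nontrivial closed path has an exit. -/
theorem ConditionL.exists_isExit (hL : ConditionL V) {a : V} (p : Quiver.Path a a)
    (hp : 0 < p.length) : ∃ e, IsExit e p := by
  induction hn : p.length using Nat.strong_induction_on generalizing a with
  | _ n ih =>
    -- A closed path that is not a cycle contains a strictly shorter closed path, every exit of
    -- which is an exit of the whole.
    rcases pairwise_or_exists_closed_subpath p with h | ⟨x, q, c, r, hc, hr, rfl⟩
    · exact hL a p ⟨hp, h⟩
    · obtain ⟨e, f, hf, hef⟩ := ih c.length
        (by simp only [Quiver.Path.length_comp] at hn; omega) c hc rfl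
      refine ⟨e, f, ?_, hef⟩
      simp [edges_comp, hf]

end DirectedGraph

namespace LeavittPathAlgebra

universe k v u

open LeavittPath DirectedGraph

section

variable (K : Type k) [Field K] {V : Type u} [Quiver.{v} V]

/-! ### Calculus of paths and ghost paths. -/

theorem mk_eq_mk_of_rel {x y : FreeAlg K V} (h : Rel K x y) : mk K V x = mk K V y :=
  ((con K V).eq).2 (.of _ _ ⟨1, x, y, h, (one_smul ..).symm, (one_smul ..).symm⟩)

theorem vertex_mul_self (w : V) : vertex K w * vertex K w = vertex K w :=
  mk_eq_mk_of_rel K (.vertex_idem w)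

theorem vertex_mul_of_ne {w w' : V} (h : w ≠ w') : vertex K w * vertex K w' = 0 :=
  mk_eq_mk_of_rel K (.vertex_orth w w' h)

theorem vertex_mul_edge (e : Quiver.Total V) : vertex K e.left * edge K e = edge K e :=
  mk_eq_mk_of_rel K (.source_edge e)

theorem edge_mul_vertex (e : Quiver.Total V) : edge K e * vertex K e.right = edge K e :=
  mk_eq_mk_of_rel K (.edge_range e)

theorem vertex_mul_ghost (e : Quiver.Total V) : vertex K e.right * ghost K e = ghost K e :=
  mk_eq_mk_of_rel K (.range_ghost e)

theorem ghost_mul_vertex (e : Quiver.Total V) : ghost K e * vertex K e.left = ghost K e :=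
  mk_eq_mk_of_rel K (.ghost_source e)

theorem ghost_mul_edge_self (e : Quiver.Total V) : ghost K e * edge K e = vertex K e.right :=
  mk_eq_mk_of_rel K (.ghost_edge_self e)

theorem ghost_mul_edge_of_ne {e f : Quiver.Total V} (h : e ≠ f) : ghost K e * edge K f = 0 :=
  mk_eq_mk_of_rel K (.ghost_edge_ne e f h)

theorem vertex_eq_sum (w : V) (hfin : (emitted w).Finite) (hne : (emitted w).Nonempty) :
    vertex K w = ∑ e ∈ hfin.toFinset, edge K e * ghost K e := by
  refine (mk_eq_mk_of_rel K (.regular w hfin hne)).trans ?_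
  exact map_sum ({ toFun := mk K V, map_zero' := rfl, map_add' := fun _ _ => rfl } :
    FreeAlg K V →+ LeavittPathAlgebra K V) _ _

theorem ghost_mul_vertex_of_ne {e : Quiver.Total V} {w : V} (h : e.left ≠ w) :
    ghost K e * vertex K w = 0 := by
  rw [← ghost_mul_vertex, mul_assoc, vertex_mul_of_ne K h, mul_zero]

theorem vertex_mul_path {a b : V} (p : Quiver.Path a b) : vertex K a * path K p = path K p := by
  induction p with
  | nil => exact vertex_mul_self K a
  | cons p e ih => rw [path, ← mul_assoc, ih]

theorem path_mul_vertex {a b : V} (p : Quiver.Path a b) : path K p * vertex K b = path K p := by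
  cases p with
  | nil => exact vertex_mul_self K a
  | cons p e => rw [path, mul_assoc, edge_mul_vertex K ⟨_, _, e⟩]

theorem pathStar_mul_vertex {a b : V} (p : Quiver.Path a b) :
    pathStar K p * vertex K a = pathStar K p := by
  induction p with
  | nil => exact vertex_mul_self K a
  | cons p e ih => rw [pathStar, mul_assoc, ih]

theorem vertex_mul_pathStar {a b : V} (p : Quiver.Path a b) :
    vertex K b * pathStar K p = pathStar K p := by
  cases p with
  | nil => exact vertex_mul_self K a
  | cons p e => rw [pathStar, ← mul_assoc, vertex_mul_ghost K ⟨_, _, e⟩]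

theorem path_mul_vertex_of_ne {a b w : V} (p : Quiver.Path a b) (h : b ≠ w) :
    path K p * vertex K w = 0 := by
  rw [← path_mul_vertex, mul_assoc, vertex_mul_of_ne K h, mul_zero]

theorem pathStar_mul_vertex_of_ne {a b w : V} (p : Quiver.Path a b) (h : a ≠ w) :
    pathStar K p * vertex K w = 0 := by
  rw [← pathStar_mul_vertex, mul_assoc, vertex_mul_of_ne K h, mul_zero]

theorem path_comp {a b c : V} (p : Quiver.Path a b) (q : Quiver.Path b c) :
    path K (p.comp q) = path K p * path K q := by
  induction q with
  | nil => exact (path_mul_vertex K p).symm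
  | cons q e ih => rw [Quiver.Path.comp_cons, path, ih, path, mul_assoc]

theorem pathStar_comp {a b c : V} (p : Quiver.Path a b) (q : Quiver.Path b c) :
    pathStar K (p.comp q) = pathStar K q * pathStar K p := by
  induction q with
  | nil => exact (vertex_mul_pathStar K p).symm
  | cons q e ih => rw [Quiver.Path.comp_cons, pathStar, ih, pathStar, mul_assoc]

theorem path_toPath {a b : V} (e : a ⟶ b) : path K e.toPath = edge K ⟨a, b, e⟩ :=
  vertex_mul_edge K ⟨a, b, e⟩

theorem pathStar_toPath {a b : V} (e : a ⟶ b) : pathStar K e.toPath = ghost K ⟨a, b, e⟩ :=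
  ghost_mul_vertex K ⟨a, b, e⟩

theorem pathStar_mul_path_self {a b : V} (p : Quiver.Path a b) :
    pathStar K p * path K p = vertex K b := by
  induction p with
  | nil => exact vertex_mul_self K a
  | cons p e ih =>
    rw [path, pathStar, mul_assoc, ← mul_assoc (pathStar K p), ih, vertex_mul_edge K ⟨_, _, e⟩,
      ghost_mul_edge_self]

/-- For `l(p) ≤ l(q)` the product `p* q` vanishes unless `q = p r`, and then it is `r`. -/
theorem pathStar_mul_path {a b a' c : V} (p : Quiver.Path a b) (q : Quiver.Path a' c)
    (h : p.length ≤ q.length) :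
    pathStar K p * path K q = 0 ∨ ∃ r : Quiver.Path b c,
      (⟨a', q⟩ : Σ x, Quiver.Path x c) = ⟨a, p.comp r⟩ ∧ pathStar K p * path K q = path K r := by
  induction p with
  | nil =>
    by_cases ha : a = a'
    · subst ha
      exact .inr ⟨q, by rw [Quiver.Path.nil_comp], vertex_mul_path K q⟩
    · left
      rw [pathStar, ← vertex_mul_path, ← mul_assoc, vertex_mul_of_ne K ha, zero_mul]
  | cons p e ih =>
    rcases ih (by rw [Quiver.Path.length_cons] at h; omega) with h0 | ⟨r, hr, hpr⟩
    · exact .inl (by rw [pathStar, mul_assoc, h0, mul_zero])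
    · obtain ⟨rfl, hq⟩ := Sigma.mk.inj_iff.1 hr
      obtain rfl := eq_of_heq hq
      -- The length bound leaves at least one edge in the remainder, to be compared with `e`.
      have hr0 : r.length ≠ 0 := by
        rw [Quiver.Path.length_cons, Quiver.Path.length_comp] at h; omega
      obtain ⟨x, f, r, rfl, -⟩ := r.length_ne_zero_iff_eq_comp.1 hr0
      by_cases hef : (⟨_, _, e⟩ : Quiver.Total V) = ⟨_, _, f⟩
      · obtain ⟨-, rfl, hef⟩ := Quiver.Total.mk.inj hef
        obtain rfl := eq_of_heq hef
        refine .inr ⟨r, ?_, ?_⟩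
        · rw [← Quiver.Path.comp_assoc]; rfl
        · rw [pathStar, mul_assoc, hpr, path_comp, path_toPath, ← mul_assoc, ghost_mul_edge_self,
            vertex_mul_path]
      · left
        rw [pathStar, mul_assoc, hpr, path_comp, path_toPath, ← mul_assoc,
          ghost_mul_edge_of_ne K hef, zero_mul]

/-- Conjugating a nontrivial closed path gives zero or a nontrivial closed path. -/
theorem conj_closed_path {a b : V} (p : Quiver.Path a b) (c : Quiver.Path a a)
    (hc : 0 < c.length) :
    pathStar K p * path K c * path K p = 0 ∨ ∃ d : Quiver.Path b b, 0 < d.length ∧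
      pathStar K p * path K c * path K p = path K d := by
  rw [mul_assoc, ← path_comp]
  refine (pathStar_mul_path K p (c.comp p) (by simp [Quiver.Path.length_comp])).imp_right ?_
  rintro ⟨d, hd, h⟩
  refine ⟨d, ?_, h⟩
  have := congrArg Quiver.Path.length (eq_of_heq (Sigma.mk.inj_iff.1 hd).2)
  simp only [Quiver.Path.length_comp] at this
  omega

/-- Let an exit e leave c = qfr at the source of f, and take p = qe. Then p*c = e*(q*q)fr = e*fr =
0, since e ≠ f. -/
theorem exists_conj_closed_path_eq_zero (hL : ConditionL V) {a : V} (c : Quiver.Path a a)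
    (hc : 0 < c.length) :
    ∃ (b : V) (p : Quiver.Path a b), pathStar K p * path K c * path K p = 0 := by
  obtain ⟨⟨x, y, e⟩, f, hf, rfl, hne⟩ := hL.exists_isExit c hc
  obtain ⟨q, r, rfl⟩ := exists_eq_comp_of_mem_edges c hf
  refine ⟨y, q.cons e, ?_⟩
  have h : pathStar K (q.cons e) * path K (q.cons f.hom) = 0 := by
    rw [path, pathStar, mul_assoc, ← mul_assoc (pathStar K q), pathStar_mul_path_self,
      vertex_mul_edge K ⟨_, _, f.hom⟩]
    exact ghost_mul_edge_of_ne K hne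
  rw [path_comp, ← mul_assoc, h, zero_mul, zero_mul]

end

section

variable (K : Type k) [Field K] (V : Type u) [Quiver.{v} V]

/-! ### Filtration by ghost length. -/

/-- The span of the paths `p` with `t * l(p) = n`. -/
noncomputable def pathSpan (t n : ℤ) : Submodule K (LeavittPathAlgebra K V) :=
  Submodule.span K {x | ∃ (a b : V) (p : Quiver.Path a b), t * p.length = n ∧ x = path K p}

/-- The span of the elements `p q*` with `t * (l(p) - l(q)) = n` and `l(q) ≤ d`. -/
noncomputable def filtration (t : ℤ) : ℕ → ℤ → Submodule K (LeavittPathAlgebra K V)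
  | 0, n => pathSpan K V t n
  | d + 1, n => pathSpan K V t n ⊔ ⨆ e : Quiver.Total V,
      (filtration t d (n + t)).map (LinearMap.mulRight K (ghost K e))

variable {K V} {t n : ℤ} {d : ℕ} {x : LeavittPathAlgebra K V}

theorem path_mem_pathSpan {a b : V} (p : Quiver.Path a b) (h : t * p.length = n) :
    path K p ∈ pathSpan K V t n :=
  Submodule.subset_span ⟨a, b, p, h, rfl⟩

theorem pathSpan_le_filtration : pathSpan K V t n ≤ filtration K V t d n := by
  cases d with
  | zero => exact le_rfl
  | succ d => exact le_sup_left

theorem mul_ghost_mem_filtration (hx : x ∈ filtration K V t d (n + t)) (e : Quiver.Total V) :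
    x * ghost K e ∈ filtration K V t (d + 1) n :=
  Submodule.mem_sup_right (Submodule.mem_iSup_of_mem e ⟨x, hx, rfl⟩)

theorem filtration_succ_le {M : Submodule K (LeavittPathAlgebra K V)}
    (hp : pathSpan K V t n ≤ M)
    (hg : ∀ y ∈ filtration K V t d (n + t), ∀ e, y * ghost K e ∈ M) :
    filtration K V t (d + 1) n ≤ M := by
  refine sup_le hp (iSup_le fun e => ?_)
  rintro _ ⟨y, hy, rfl⟩
  exact hg y hy e

theorem exists_eq_add_sum_of_mem_filtration_succ (hx : x ∈ filtration K V t (d + 1) n) :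
    ∃ y ∈ pathSpan K V t n, ∃ (s : Finset (Quiver.Total V))
      (z : Quiver.Total V → LeavittPathAlgebra K V), (∀ e, z e ∈ filtration K V t d (n + t)) ∧
      x = y + ∑ e ∈ s, z e * ghost K e := by
  obtain ⟨y, hy, w, hw, rfl⟩ := Submodule.mem_sup.1 hx
  obtain ⟨f, hf, rfl⟩ := (Submodule.mem_iSup_iff_exists_finsupp _ _).1 hw
  choose z hz hzf using hf
  exact ⟨y, hy, f.support, z, hz, congrArg (y + ·) (Finset.sum_congr rfl fun e _ => (hzf e).symm)⟩

theorem filtration_le_succ : filtration K V t d n ≤ filtration K V t (d + 1) n := by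
  induction d generalizing n with
  | zero => exact pathSpan_le_filtration
  | succ d ih =>
    exact filtration_succ_le pathSpan_le_filtration fun y hy e =>
      mul_ghost_mem_filtration (ih hy) e

theorem mul_mem_of_mem_pathSpan {M : Submodule K (LeavittPathAlgebra K V)}
    (g : LeavittPathAlgebra K V)
    (h : ∀ (a b : V) (p : Quiver.Path a b), t * p.length = n → path K p * g ∈ M)
    (hx : x ∈ pathSpan K V t n) : x * g ∈ M := by
  refine (Submodule.span_le (p := M.comap (LinearMap.mulRight K g))).2 ?_ hx
  rintro _ ⟨a, b, p, hp, rfl⟩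
  exact h a b p hp

theorem mul_vertex_mem_pathSpan (hx : x ∈ pathSpan K V t n) (w : V) :
    x * vertex K w ∈ pathSpan K V t n := by
  refine mul_mem_of_mem_pathSpan _ (fun a b p hp => ?_) hx
  by_cases h : b = w
  · subst h
    rw [path_mul_vertex]
    exact path_mem_pathSpan p hp
  · rw [path_mul_vertex_of_ne K p h]
    exact zero_mem _

theorem mul_edge_mem_pathSpan (hx : x ∈ pathSpan K V t n) (e : Quiver.Total V) :
    x * edge K e ∈ pathSpan K V t (n + t) := by
  obtain ⟨b', c, e⟩ := e
  refine mul_mem_of_mem_pathSpan _ (fun a b p hp => ?_) hx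
  by_cases h : b = b'
  · subst h
    exact path_mem_pathSpan (p.cons e)
      (by rw [Quiver.Path.length_cons, ← hp]; push_cast; ring)
  · rw [← vertex_mul_edge, ← mul_assoc, path_mul_vertex_of_ne K p h, zero_mul]
    exact zero_mem _

theorem mul_vertex_mem_filtration (hx : x ∈ filtration K V t d n) (w : V) :
    x * vertex K w ∈ filtration K V t d n := by
  cases d with
  | zero => exact mul_vertex_mem_pathSpan hx w
  | succ d =>
    refine filtration_succ_le (M := (filtration K V t (d + 1) n).comap
      (LinearMap.mulRight K (vertex K w))) (fun y hy => ?_) (fun y hy e => ?_) hx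
    · change y * vertex K w ∈ filtration K V t (d + 1) n
      exact pathSpan_le_filtration (mul_vertex_mem_pathSpan hy w)
    · rw [Submodule.mem_comap, LinearMap.mulRight_apply, mul_assoc]
      by_cases h : e.left = w
      · subst h
        rw [ghost_mul_vertex]
        exact mul_ghost_mem_filtration hy e
      · rw [ghost_mul_vertex_of_ne K h, mul_zero]
        exact zero_mem _

/-- The edge either cancels the last ghost edge or kills the term, and a term without ghost edges
just becomes a longer path. This drop in `d` drives the main induction. -/
theorem mul_edge_mem_filtration_succ (hx : x ∈ filtration K V t (d + 1) n) (e : Quiver.Total V) :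
    x * edge K e ∈ filtration K V t d (n + t) := by
  refine filtration_succ_le (M := (filtration K V t d (n + t)).comap
    (LinearMap.mulRight K (edge K e))) (fun y hy => ?_) (fun y hy f => ?_) hx
  · exact pathSpan_le_filtration (mul_edge_mem_pathSpan hy e)
  · rw [Submodule.mem_comap, LinearMap.mulRight_apply, mul_assoc]
    by_cases h : f = e
    · subst h
      rw [ghost_mul_edge_self]
      exact mul_vertex_mem_filtration hy _
    · rw [ghost_mul_edge_of_ne K h, mul_zero]
      exact zero_mem _

variable (K V) in
/-- The union of the filtration in a fixed degree. -/
noncomputable def filtrationUnion (t n : ℤ) : Submodule K (LeavittPathAlgebra K V) :=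
  ⨆ d, filtration K V t d n

theorem filtration_mono : Monotone fun d => filtration K V t d n :=
  monotone_nat_of_le_succ fun _ => filtration_le_succ

theorem mem_filtrationUnion : x ∈ filtrationUnion K V t n ↔ ∃ d, x ∈ filtration K V t d n :=
  Submodule.mem_iSup_of_directed _ filtration_mono.directed_le

theorem vertex_mem_filtrationUnion (w : V) : vertex K w ∈ filtrationUnion K V t 0 :=
  mem_filtrationUnion.2 ⟨0, path_mem_pathSpan (.nil : Quiver.Path w w) (by simp)⟩

/-- Writing degrees as `t * m` covers both values of `t`: a generator shifts `m` by 0, 1 or -1,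
which has no effect when `t = 0`. -/
theorem mul_mk_gen_mem_filtrationUnion {m : ℤ} (hx : x ∈ filtrationUnion K V t (t * m))
    (g : Generator V) : ∃ m', x * mk K V (FreeAlg.gen K g) ∈ filtrationUnion K V t (t * m') := by
  obtain ⟨d, hd⟩ := mem_filtrationUnion.1 hx
  cases g with
  | vertex w => exact ⟨m, mem_filtrationUnion.2 ⟨d, mul_vertex_mem_filtration hd w⟩⟩
  | edge e =>
    refine ⟨m + 1, mem_filtrationUnion.2 ⟨d, ?_⟩⟩
    rw [mul_add, mul_one]
    exact mul_edge_mem_filtration_succ (filtration_le_succ hd) e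
  | ghost e =>
    refine ⟨m - 1, mem_filtrationUnion.2 ⟨d + 1, mul_ghost_mem_filtration ?_ e⟩⟩
    rwa [mul_sub, mul_one, sub_add_cancel]

theorem mul_mk_single_mem_filtrationUnion (w : FreeSemigroup (Generator V)) :
    ∀ {x : LeavittPathAlgebra K V} {m : ℤ}, x ∈ filtrationUnion K V t (t * m) →
      ∃ m', x * mk K V (MonoidAlgebra.single w 1) ∈ filtrationUnion K V t (t * m') := by
  induction w using FreeSemigroup.recOnMul with
  | ih1 g => exact fun hx => mul_mk_gen_mem_filtrationUnion hx g
  | ih2 g w hg hw =>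
    intro x m hx
    obtain ⟨m', hm'⟩ := hg hx
    obtain ⟨m'', hm''⟩ := hw hm'
    refine ⟨m'', ?_⟩
    rw [mul_assoc] at hm''
    convert hm'' using 2
    change _ = mk K V (_ * _)
    rw [MonoidAlgebra.single_mul_single, one_mul]

theorem exists_vertex_mul_mk_gen (g : Generator V) :
    ∃ w : V, vertex K w * mk K V (FreeAlg.gen K g) = mk K V (FreeAlg.gen K g) := by
  cases g with
  | vertex w => exact ⟨w, vertex_mul_self K w⟩
  | edge e => exact ⟨_, vertex_mul_edge K e⟩
  | ghost e => exact ⟨_, vertex_mul_ghost K e⟩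

theorem exists_vertex_mul_mk_single (w : FreeSemigroup (Generator V)) :
    ∃ a : V, vertex K a * mk K V (MonoidAlgebra.single w 1) =
      mk K V (MonoidAlgebra.single w 1) := by
  induction w using FreeSemigroup.recOnMul with
  | ih1 g => exact exists_vertex_mul_mk_gen g
  | ih2 g w hg hw =>
    obtain ⟨a, ha⟩ := hg
    refine ⟨a, ?_⟩
    have h : mk K V (MonoidAlgebra.single (FreeSemigroup.of g * w) 1) =
        mk K V (MonoidAlgebra.single (FreeSemigroup.of g) 1) *
          mk K V (MonoidAlgebra.single w 1) := by
      change _ = mk K V (_ * _)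
      rw [MonoidAlgebra.single_mul_single, one_mul]
    rw [h, ← mul_assoc, ha]

/-- There is no unit to start from, so each word is written as a vertex times itself; that vertex
has degree 0, and multiplying by the letters in turn stays within the pieces. -/
theorem iSup_filtrationUnion (t : ℤ) : ⨆ m : ℤ, filtrationUnion K V t (t * m) = ⊤ := by
  refine eq_top_iff.2 fun x _ => ?_
  obtain ⟨x, rfl⟩ := mk_surjective K V x
  induction x using MonoidAlgebra.induction_linear with
  | zero => exact zero_mem _
  | add x y hx hy => exact add_mem (hx trivial) (hy trivial)
  | single w c =>
    have h : mk K V (MonoidAlgebra.single w c) = c • mk K V (MonoidAlgebra.single w 1) := by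
      change _ = mk K V (c • _)
      rw [MonoidAlgebra.smul_single, smul_eq_mul, mul_one]
    obtain ⟨a, ha⟩ := exists_vertex_mul_mk_single (K := K) w
    obtain ⟨m, hm⟩ := mul_mk_single_mem_filtrationUnion (K := K) (t := t) (m := 0) w
      (by rw [mul_zero]; exact vertex_mem_filtrationUnion a)
    rw [h, ← ha]
    exact Submodule.smul_mem _ _ (Submodule.mem_iSup_of_mem m hm)

/-- Sums of vertices are local units, so an element killed by all vertices is zero. -/
theorem eq_zero_of_forall_mul_vertex (x : LeavittPathAlgebra K V)
    (h : ∀ w : V, x * vertex K w = 0) : x = 0 := by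
  classical
  -- Asking for all larger finite sets makes the property additive: two elements can share one set.
  suffices ∃ s : Finset V, ∀ s', s ⊆ s' → x = ∑ w ∈ s', x * vertex K w by
    obtain ⟨s, hs⟩ := this
    rw [hs s subset_rfl, Finset.sum_eq_zero fun w _ => h w]
  clear h
  let U : Submodule K (LeavittPathAlgebra K V) :=
    { carrier := {x | ∃ s : Finset V, ∀ s', s ⊆ s' → x = ∑ w ∈ s', x * vertex K w}
      zero_mem' := ⟨∅, by simp⟩
      add_mem' := by
        rintro x y ⟨s, hs⟩ ⟨s', hs'⟩
        refine ⟨s ∪ s', fun r hr => ?_⟩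
        simp only [add_mul, Finset.sum_add_distrib]
        rw [← hs r (Finset.union_subset_left hr), ← hs' r (Finset.union_subset_right hr)]
      smul_mem' := by
        rintro c x ⟨s, hs⟩
        refine ⟨s, fun r hr => ?_⟩
        simp only [smul_mul_assoc, ← Finset.smul_sum]
        rw [← hs r hr] }
  have hU (x : LeavittPathAlgebra K V) (w : V) (hx : x * vertex K w = x) : x ∈ U := by
    refine ⟨{w}, fun s hs => ?_⟩
    rw [Finset.sum_eq_single w, hx]
    · intro w' _ hne
      rw [← hx, mul_assoc, vertex_mul_of_ne K hne.symm, mul_zero]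
    · exact fun hw => (hw (Finset.singleton_subset_iff.1 hs)).elim
  have hP (n : ℤ) : pathSpan K V 1 n ≤ U := by
    refine Submodule.span_le.2 ?_
    rintro _ ⟨a, b, p, -, rfl⟩
    exact hU _ b (path_mul_vertex K p)
  have hF (d : ℕ) (n : ℤ) : filtration K V 1 d n ≤ U := by
    cases d with
    | zero => exact hP n
    | succ d =>
      refine filtration_succ_le (hP n) fun y _ e => hU _ e.left ?_
      rw [mul_assoc, ghost_mul_vertex]
  have hx : x ∈ ⨆ m : ℤ, filtrationUnion K V 1 (1 * m) := by
    rw [iSup_filtrationUnion]; trivial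
  exact iSup_le (fun m => iSup_le fun d => hF d _) hx

/-- This transfers the grading hypothesis on `π` to the filtration. -/
theorem filtration_one_le_component : filtration K V 1 d n ≤ component K V n := by
  have hP (n : ℤ) : pathSpan K V 1 n ≤ component K V n := by
    refine Submodule.span_le.2 ?_
    rintro _ ⟨a, b, p, hp, rfl⟩
    refine Submodule.subset_span ⟨a, b, b, b, p, .nil, ?_, (path_mul_vertex K p).symm⟩
    rw [← hp]; simp
  induction d generalizing n with
  | zero => exact hP n
  | succ d ih =>
    refine filtration_succ_le (hP n) fun y hy e => ?_
    refine (Submodule.span_le (p := (component K V n).comap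
      (LinearMap.mulRight K (ghost K e)))).2 ?_ (ih hy)
    rintro _ ⟨a, b, c, c', p, q, hpq, rfl⟩
    obtain ⟨x, y, e⟩ := e
    change path K p * pathStar K q * ghost K ⟨x, y, e⟩ ∈ component K V n
    by_cases h : c = y
    · subst h
      refine Submodule.subset_span ⟨a, b, x, c', p, e.toPath.comp q, ?_, ?_⟩
      · simp only [Quiver.Path.length_comp, Quiver.Hom.toPath, Quiver.Path.length_cons,
          Quiver.Path.length_nil]
        push_cast
        linarith
      · rw [pathStar_comp, pathStar_toPath, mul_assoc]
    · rw [← vertex_mul_ghost, mul_assoc, ← mul_assoc (pathStar K q),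
        pathStar_mul_vertex_of_ne K q h, zero_mul, mul_zero]
      exact zero_mem _

end

section

variable {K : Type k} [Field K] {V : Type u} [Quiver.{v} V] {A : Type*} [NonUnitalRing A]

/-! ### From independence of paths to injectivity. -/

/-- As `π` need not be `K`-linear, the scalar is cancelled inside the algebra, by multiplying with
`c⁻¹ • vertex K w`. -/
theorem map_smul_vertex_ne_zero {π : LeavittPathAlgebra K V →ₙ+* A} {w : V}
    (hw : π (vertex K w) ≠ 0) {c : K} (h : π (c • vertex K w) = 0) : c = 0 := by
  by_contra hc
  refine hw ?_
  have : vertex K w = (c⁻¹ • vertex K w) * (c • vertex K w) := by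
    rw [smul_mul_smul_comm, inv_mul_cancel₀ hc, one_smul, vertex_mul_self]
  rw [this, map_mul, h, mul_zero]

/-- The paths `p` ending at a common vertex with `t * l(p)` fixed are linearly independent modulo
the kernel of `π`. -/
def IndepPaths (π : LeavittPathAlgebra K V →ₙ+* A) (t : ℤ) : Prop :=
  ∀ (n : ℤ) (w : V) (c : (Σ a, Quiver.Path a w) →₀ K),
    (∀ p ∈ c.support, t * (p.2.length : ℤ) = n) →
    π (Finsupp.linearCombination K (fun p : Σ a, Quiver.Path a w => path K p.2) c) = 0 → c = 0

theorem exists_linearCombination_of_mem_pathSpan {t n : ℤ} {x : LeavittPathAlgebra K V}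
    (hx : x ∈ pathSpan K V t n) (w : V) : ∃ c : (Σ a, Quiver.Path a w) →₀ K,
      (∀ p ∈ c.support, t * (p.2.length : ℤ) = n) ∧
      Finsupp.linearCombination K (fun p : Σ a, Quiver.Path a w => path K p.2) c =
        x * vertex K w := by
  have h : x * vertex K w ∈ Submodule.span K ((fun p : Σ a, Quiver.Path a w => path K p.2) ''
      {p | t * (p.2.length : ℤ) = n}) := by
    refine mul_mem_of_mem_pathSpan _ (fun a b p hp => ?_) hx
    by_cases h : b = w
    · subst h
      rw [path_mul_vertex]
      exact Submodule.subset_span ⟨⟨a, p⟩, hp, rfl⟩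
    · rw [path_mul_vertex_of_ne K p h]
      exact zero_mem _
  obtain ⟨c, hc, hcx⟩ := (Finsupp.mem_span_image_iff_linearCombination K).1 h
  exact ⟨c, fun p hp => hc hp, hcx⟩

namespace IndepPaths

variable {π : LeavittPathAlgebra K V →ₙ+* A} {t : ℤ} (H : IndepPaths π t)
include H

theorem mul_vertex_eq_zero {n : ℤ} {x : LeavittPathAlgebra K V} (hx : x ∈ pathSpan K V t n)
    {w : V} (h : π (x * vertex K w) = 0) : x * vertex K w = 0 := by
  obtain ⟨c, hc, hcx⟩ := exists_linearCombination_of_mem_pathSpan hx w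
  rw [← hcx] at h ⊢
  rw [H n w c hc h, map_zero]

/-- Appending `e` is injective on paths ending at its source, so x s(e) and xe have the same
coefficients, and independence at the range of `e` makes them vanish. -/
theorem mul_vertex_eq_zero_of_mul_edge {n : ℤ} {x : LeavittPathAlgebra K V}
    (hx : x ∈ pathSpan K V t n) {e : Quiver.Total V} (h : x * edge K e = 0) :
    x * vertex K e.left = 0 := by
  obtain ⟨a, b, e⟩ := e
  obtain ⟨c, hc, hcx⟩ := exists_linearCombination_of_mem_pathSpan hx a
  let f : (Σ x, Quiver.Path x a) → Σ x, Quiver.Path x b := fun p => ⟨p.1, p.2.cons e⟩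
  have hf : Function.Injective f := by
    rintro ⟨x, p⟩ ⟨y, q⟩ hpq
    obtain ⟨rfl, hpq⟩ := Sigma.mk.inj_iff.1 hpq
    obtain ⟨-, hpq, -⟩ := Quiver.Path.cons.inj (eq_of_heq hpq)
    exact congrArg (Sigma.mk x) (eq_of_heq hpq)
  have hcf : c.mapDomain f = 0 := by
    classical
    refine H (n + t) b _ (fun p hp => ?_) ?_
    · obtain ⟨q, hq, rfl⟩ := Finset.mem_image.1 (Finsupp.mapDomain_support hp)
      have := hc q hq
      simp only [f, Quiver.Path.length_cons]
      push_cast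
      linarith
    · rw [Finsupp.linearCombination_mapDomain]
      have : Finsupp.linearCombination K
          ((fun p : Σ x, Quiver.Path x b => path K p.2) ∘ f) c =
          x * vertex K a * edge K ⟨a, b, e⟩ := by
        rw [← hcx, Finsupp.linearCombination_apply, Finsupp.linearCombination_apply,
          Finsupp.sum_mul]
        exact Finsupp.sum_congr fun p _ => (smul_mul_assoc ..).symm
      rw [this, mul_assoc, vertex_mul_edge K ⟨a, b, e⟩, h, map_zero]
  rw [← hcx, Finsupp.mapDomain_injective hf (hcf.trans Finsupp.mapDomain_zero.symm), map_zero]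

theorem eq_zero_of_mem_filtration {d : ℕ} {n : ℤ} {x : LeavittPathAlgebra K V}
    (hx : x ∈ filtration K V t d n) (h : π x = 0) : x = 0 := by
  classical
  induction d generalizing n x with
  | zero =>
    exact eq_zero_of_forall_mul_vertex x fun w =>
      H.mul_vertex_eq_zero hx (by rw [map_mul, h, zero_mul])
  | succ d ih =>
    have hedge (e : Quiver.Total V) : x * edge K e = 0 :=
      ih (mul_edge_mem_filtration_succ hx e) (by rw [map_mul, h, zero_mul])
    obtain ⟨y, hy, s, z, -, hxy⟩ := exists_eq_add_sum_of_mem_filtration_succ hx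
    refine eq_zero_of_forall_mul_vertex x fun w => ?_
    by_cases hfin : (emitted w).Finite ∧ (emitted w).Nonempty
    · rw [vertex_eq_sum K w hfin.1 hfin.2, Finset.mul_sum]
      exact Finset.sum_eq_zero fun e _ => by rw [← mul_assoc, hedge, zero_mul]
    -- Of the ghost terms only the one ending in e* survives multiplication by e.
    have hsum (e : Quiver.Total V) :
        x * edge K e = y * edge K e + if e ∈ s then z e * vertex K e.right else 0 := by
      rw [hxy, add_mul, Finset.sum_mul]
      congr 1
      rw [← Finset.sum_ite_eq' s e fun e => z e * vertex K e.right]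
      refine Finset.sum_congr rfl fun f _ => ?_
      rw [mul_assoc]
      by_cases hfe : f = e
      · rw [if_pos hfe, hfe, ghost_mul_edge_self]
      · rw [if_neg hfe, ghost_mul_edge_of_ne K hfe, mul_zero]
    have hxw : x * vertex K w =
        y * vertex K w + ∑ e ∈ s, z e * ghost K e * vertex K w := by
      rw [hxy, add_mul, Finset.sum_mul]
    -- An infinite emitter has an edge e outside the finite set `s`, so 0 = xe = ye. At a sink no
    -- ghost term survives, so xw = yw lies in the kernel.
    have hyw : y * vertex K w = 0 := by
      by_cases hne : (emitted w).Nonempty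
      · have hinf : (emitted w).Infinite := fun hf => hfin ⟨hf, hne⟩
        obtain ⟨e, rfl, hes⟩ := hinf.exists_notMem_finset s
        refine H.mul_vertex_eq_zero_of_mul_edge hy ?_
        have := hsum e
        rwa [if_neg hes, add_zero, hedge, eq_comm] at this
      · refine H.mul_vertex_eq_zero hy ?_
        rw [Finset.sum_eq_zero, add_zero] at hxw
        · rw [← hxw, map_mul, h, zero_mul]
        · intro e _
          rw [mul_assoc, ghost_mul_vertex_of_ne K fun he => hne ⟨e, he⟩, mul_zero]
    rw [hxw, hyw, zero_add]
    refine Finset.sum_eq_zero fun e he => ?_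
    rw [mul_assoc]
    by_cases hew : e.left = w
    · have := hsum e
      rw [if_pos he, hedge, ← vertex_mul_edge, ← mul_assoc, hew, hyw, zero_mul, zero_add] at this
      rw [← hew, ghost_mul_vertex, ← vertex_mul_ghost, ← mul_assoc, ← this, zero_mul]
    · rw [ghost_mul_vertex_of_ne K hew, mul_zero]

theorem eq_zero_of_mem_filtrationUnion {n : ℤ} {x : LeavittPathAlgebra K V}
    (hx : x ∈ filtrationUnion K V t n) (h : π x = 0) : x = 0 := by
  obtain ⟨d, hd⟩ := mem_filtrationUnion.1 hx
  exact H.eq_zero_of_mem_filtration hd h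

end IndepPaths

/-- Multiplying a nonzero combination of paths with common range by the adjoint of a path of
minimal length leaves a nonzero multiple of a vertex plus nontrivial closed paths. -/
theorem exists_pathStar_mul_linearCombination {w : V} {c : (Σ a, Quiver.Path a w) →₀ K}
    (hc : c ≠ 0) : ∃ p₀ ∈ c.support, ∃ s ⊆ c.support,
      pathStar K p₀.2 * Finsupp.linearCombination K
        (fun p : Σ a, Quiver.Path a w => path K p.2) c =
      c p₀ • vertex K w + ∑ p ∈ s, c p • (pathStar K p₀.2 * path K p.2) ∧
      ∀ p ∈ s, pathStar K p₀.2 * path K p.2 = 0 ∨ ∃ r : Quiver.Path w w,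
        p.2.length = p₀.2.length + r.length ∧ 0 < r.length ∧
          pathStar K p₀.2 * path K p.2 = path K r := by
  classical
  -- Minimality ensures that p₀*p is zero or a path for every other p, and never a proper ghost
  -- path.
  obtain ⟨p₀, hp₀, hmin⟩ := c.support.exists_min_image (fun p => p.2.length)
    (Finsupp.support_nonempty_iff.2 hc)
  refine ⟨p₀, hp₀, c.support \ {p₀}, Finset.sdiff_subset, ?_, fun p hp => ?_⟩
  · rw [Finsupp.linearCombination_apply, Finsupp.sum, Finset.mul_sum,
      ← Finset.sum_sdiff (Finset.singleton_subset_iff.2 hp₀), Finset.sum_singleton, add_comm,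
      mul_smul_comm, pathStar_mul_path_self]
    simp only [mul_smul_comm]
  · obtain ⟨hp, hne⟩ := Finset.mem_sdiff.1 hp
    refine (pathStar_mul_path K p₀.2 p.2 (hmin p hp)).imp_right ?_
    rintro ⟨r, hr, h⟩
    have hlen : p.2.length = p₀.2.length + r.length := by
      obtain ⟨a, p⟩ := p
      obtain ⟨rfl, hr⟩ := Sigma.mk.inj_iff.1 hr
      rw [eq_of_heq hr, Quiver.Path.length_comp]
    refine ⟨r, hlen, Nat.pos_of_ne_zero fun hr0 => hne ?_, h⟩
    rw [Quiver.Path.eq_nil_of_length_zero r hr0, Quiver.Path.comp_nil] at hr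
    exact Finset.mem_singleton.2 hr

/-! ### Independence from the grading and from Condition (L). -/

/-- For `t = 1` all paths involved have equal length, which excludes nontrivial closed remainders.
-/
theorem indepPaths_one {π : LeavittPathAlgebra K V →ₙ+* A} (hπ : ∀ w, π (vertex K w) ≠ 0) :
    IndepPaths π 1 := by
  intro n w c hn h
  by_contra hc
  obtain ⟨p₀, hp₀, s, hs, heq, hp⟩ := exists_pathStar_mul_linearCombination hc
  rw [Finset.sum_eq_zero, add_zero] at heq
  · refine Finsupp.mem_support_iff.1 hp₀ (map_smul_vertex_ne_zero (hπ w) ?_)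
    rw [← heq, map_mul, h, mul_zero]
  · intro p hps
    rcases hp p hps with h0 | ⟨r, hr, hr0, -⟩
    · rw [h0, smul_zero]
    · have h₁ := hn p (hs hps)
      have h₂ := hn p₀ hp₀
      omega

/-- Induction on the number of terms. Conjugating by a path p that kills one closed path sends each
other term to zero or to a nontrivial closed path, and turns k w into k r(p), so `k` is unchanged
while the base vertex moves. -/
theorem eq_zero_of_map_smul_vertex_add_sum (hL : ConditionL V)
    {π : LeavittPathAlgebra K V →ₙ+* A} (hπ : ∀ w, π (vertex K w) ≠ 0) {ι : Type*}
    (s : Finset ι) (g : ι → K) (k : K) {w : V} {f : ι → LeavittPathAlgebra K V}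
    (hf : ∀ i ∈ s, f i = 0 ∨ ∃ r : Quiver.Path w w, 0 < r.length ∧ f i = path K r)
    (h : π (k • vertex K w + ∑ i ∈ s, g i • f i) = 0) : k = 0 := by
  classical
  induction s using Finset.induction_on generalizing w f with
  | empty =>
    rw [Finset.sum_empty, add_zero] at h
    exact map_smul_vertex_ne_zero (hπ w) h
  | insert i s hi ih =>
    rw [Finset.sum_insert hi] at h
    rcases hf i (Finset.mem_insert_self i s) with h0 | ⟨r, hr, hir⟩
    · rw [h0, smul_zero, zero_add] at h
      exact ih (fun j hj => hf j (Finset.mem_insert_of_mem hj)) h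
    · obtain ⟨b, p, hp⟩ := exists_conj_closed_path_eq_zero K hL r hr
      refine ih (w := b) (f := fun j => pathStar K p * f j * path K p) (fun j hj => ?_) ?_
      · rcases hf j (Finset.mem_insert_of_mem hj) with h0 | ⟨c, hc, hjc⟩
        · simp only [h0, mul_zero, zero_mul, true_or]
        · simp only [hjc]
          exact conj_closed_path K p c hc
      · have heq : k • vertex K b + ∑ j ∈ s, g j • (pathStar K p * f j * path K p) =
            pathStar K p * (k • vertex K w + (g i • f i + ∑ j ∈ s, g j • f j)) * path K p := by
          rw [hir, mul_add, mul_add, add_mul, add_mul, mul_smul_comm, mul_smul_comm,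
            smul_mul_assoc, smul_mul_assoc, hp, smul_zero, zero_add, pathStar_mul_vertex,
            pathStar_mul_path_self, Finset.mul_sum, Finset.sum_mul]
          simp only [mul_smul_comm, smul_mul_assoc]
        rw [heq, map_mul, map_mul, h, mul_zero, zero_mul]

theorem indepPaths_of_conditionL (hL : ConditionL V) {π : LeavittPathAlgebra K V →ₙ+* A}
    (hπ : ∀ w, π (vertex K w) ≠ 0) (t : ℤ) : IndepPaths π t := by
  intro n w c _ h
  by_contra hc
  obtain ⟨p₀, hp₀, s, hs, heq, hp⟩ := exists_pathStar_mul_linearCombination hc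
  refine Finsupp.mem_support_iff.1 hp₀ (eq_zero_of_map_smul_vertex_add_sum hL hπ _ c _
    (f := fun p => pathStar K p₀.2 * path K p.2)
    (fun p hps => (hp p hps).imp_right fun ⟨r, _, hr⟩ => ⟨r, hr⟩) ?_)
  rw [← heq, map_mul, h, mul_zero]

/-! ### The two uniqueness theorems. -/

theorem injective_of_graded (𝒜 : ℤ → AddSubgroup A) (h𝒜 : DirectSum.IsInternal 𝒜)
    (π : LeavittPathAlgebra K V →ₙ+* A)
    (hgr : ∀ (n : ℤ), ∀ x ∈ component K V n, π x ∈ 𝒜 n)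
    (hπ : ∀ w : V, π (vertex K w) ≠ 0) : Function.Injective π := by
  refine (injective_iff_map_eq_zero π).2 fun x hx => ?_
  have hmem : x ∈ ⨆ n : ℤ, filtrationUnion K V 1 (1 * n) := by
    rw [iSup_filtrationUnion]; trivial
  simp only [one_mul] at hmem
  obtain ⟨f, hf, rfl⟩ := (Submodule.mem_iSup_iff_exists_finsupp _ _).1 hmem
  have hfA (n : ℤ) : π (f n) ∈ 𝒜 n := by
    obtain ⟨d, hd⟩ := mem_filtrationUnion.1 (hf n)
    exact hgr n _ (filtration_one_le_component hd)
  -- The images of the homogeneous parts are assembled in the external direct sum, where vanishing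
  -- of the total forces each of them to vanish.
  let g : DirectSum ℤ fun n => 𝒜 n :=
    ∑ n ∈ f.support, DirectSum.of (fun n => 𝒜 n) n ⟨π (f n), hfA n⟩
  have hg : g = 0 := by
    refine h𝒜.injective ?_
    rw [map_zero, map_sum, ← hx, Finsupp.sum, map_sum]
    exact Finset.sum_congr rfl fun n _ => DirectSum.coeAddMonoidHom_of _ _ _
  refine Finset.sum_eq_zero fun n hn => ?_
  refine (indepPaths_one hπ).eq_zero_of_mem_filtrationUnion (hf n) ?_
  have hgn : ((g n : 𝒜 n) : A) = 0 := by rw [hg]; rfl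
  rw [DirectSum.sum_apply, Finset.sum_eq_single n, DirectSum.of_eq_same] at hgn
  · exact hgn
  · intro m _ hmn
    exact DirectSum.of_eq_of_ne _ _ _ hmn.symm
  · exact fun h => (h hn).elim

theorem injective_of_conditionL (hL : ConditionL V) (π : LeavittPathAlgebra K V →ₙ+* A)
    (hπ : ∀ w : V, π (vertex K w) ≠ 0) : Function.Injective π := by
  refine (injective_iff_map_eq_zero π).2 fun x hx => ?_
  have hmem : x ∈ ⨆ n : ℤ, filtrationUnion K V 0 (0 * n) := by
    rw [iSup_filtrationUnion]; trivial
  -- With `t = 0` the single piece of degree 0 is the whole algebra.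
  simp only [zero_mul, iSup_const] at hmem
  exact (indepPaths_of_conditionL hL hπ 0).eq_zero_of_mem_filtrationUnion hmem hx

end

end LeavittPathAlgebra

theorem mainTheorem8 {K : Type*} [Field K] {V : Type*} [Quiver V] :
    -- graded uniqueness
    (∀ (A : Type*) [NonUnitalRing A] (𝒜 : ℤ → AddSubgroup A) [SetLike.GradedMul 𝒜],
      DirectSum.IsInternal 𝒜 →
      ∀ π : LeavittPathAlgebra K V →ₙ+* A,
        (∀ (n : ℤ), ∀ x ∈ LeavittPathAlgebra.component K V n, π x ∈ 𝒜 n) →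
        (∀ w : V, π (LeavittPathAlgebra.vertex K w) ≠ 0) →
        Function.Injective π) ∧
    -- Cuntz-Krieger uniqueness
    (DirectedGraph.ConditionL V →
      ∀ (A : Type*) [NonUnitalRing A] (π : LeavittPathAlgebra K V →ₙ+* A),
        (∀ w : V, π (LeavittPathAlgebra.vertex K w) ≠ 0) →
        Function.Injective π) :=
  ⟨fun _ _ 𝒜 _ h𝒜 π hgr hπ => LeavittPathAlgebra.injective_of_graded 𝒜 h𝒜 π hgr hπ,
    fun hL _ _ π hπ => LeavittPathAlgebra.injective_of_conditionL hL π hπ⟩
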